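/- Let $d\ge 2$ and $n\ge 2$ be integers, and let $\mu_d=\{\xi\in\mathbb{C}^*\mid \xi^d=1\}$ act on affine space $\mathbb{A}^n=\mathbb{C}^n$ over $\mathbb{C}$ by scalar multiplication. Let $A_{d,n}:=\mathbb{A}^n/\mu_d$ be the quotient, i.e. the affine variety over $\mathbb{C}$ with coordinate ring $\mathcal{O}(A_{d,n})=\mathbb{C}[x_1,\dots,x_n]^{\mu_d}$, and let $\pi:\mathbb{A}^n\to A_{d,n}$ be the quotient morphism, given by the inclusion $\mathbb{C}[x_1,\dots,x_n]^{\mu_d}\subset\mathbb{C}[x_1,\dots,x_n]$. Then every automorphism of $A_{d,n}$ lifts to a polynomial automorphism of $\mathbb{C}^n$: for every automorphism $\varphi$ of the $\mathbb{C}$-variety $A_{d,n}$ there is an automorphism $\psi$ of the $\mathbb{C}$-variety $\mathbb{A}^n$ with $\pi\circ\psi=\varphi\circ\pi$. -/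

import Mathlib

open CategoryTheory AlgebraicGeometry

noncomputable section

namespace CyclicQuotient

/-- The `ℂ`-algebra endomorphism of `ℂ[x₁, …, xₙ]` with `xᵢ ↦ ζ xᵢ`, that is,
the pull-back of polynomial functions along `v ↦ ζ • v` on affine space. -/
def scale (n : ℕ) (ζ : ℂ) : MvPolynomial (Fin n) ℂ →ₐ[ℂ] MvPolynomial (Fin n) ℂ :=
  MvPolynomial.aeval fun i => MvPolynomial.C ζ * MvPolynomial.X i

/-- The algebra of invariants `ℂ[x₁, …, xₙ]^{μ_d}` for the group `μ_d` of `d`-th roots of unity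
acting by scalar multiplication. -/
def invariants (d n : ℕ) : Subalgebra ℂ (MvPolynomial (Fin n) ℂ) :=
  ⨅ ζ : rootsOfUnity d ℂ, AlgHom.equalizer (scale n ((ζ : ℂˣ) : ℂ)) (AlgHom.id ℂ _)

theorem mem_invariants {d n : ℕ} {f : MvPolynomial (Fin n) ℂ} :
    f ∈ invariants d n ↔ ∀ ζ : rootsOfUnity d ℂ, scale n ((ζ : ℂˣ) : ℂ) f = f := by
  simp [invariants, Algebra.mem_iInf, AlgHom.mem_equalizer]

/-- The base scheme `Spec ℂ`. -/
abbrev base : Scheme.{0} := Spec (.of ℂ)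

/-- Affine `n`-space over `ℂ`. -/
abbrev affineSpace (n : ℕ) : Scheme.{0} := AffineSpace (Fin n) base

/-- The quotient variety `A_{d,n} = 𝔸ⁿ / μ_d`, the affine variety whose coordinate ring is the
algebra of invariants. -/
def quotientVariety (d n : ℕ) : Scheme.{0} := Spec (.of (invariants d n))

/-- The structure morphism of `A_{d,n}` over `ℂ`. -/
instance quotientVarietyOver (d n : ℕ) : (quotientVariety d n).Over base :=
  ⟨Spec.map (CommRingCat.ofHom (algebraMap ℂ (invariants d n)))⟩

/-- The quotient morphism `π : 𝔸ⁿ ⟶ A_{d,n}`, given on coordinate rings by the inclusion of the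
invariants in `ℂ[x₁, …, xₙ]`. -/
def quotientMap (d n : ℕ) : affineSpace n ⟶ quotientVariety d n :=
  (AffineSpace.SpecIso (Fin n) (.of ℂ)).hom ≫
    Spec.map (CommRingCat.ofHom (invariants d n).val.toRingHom)

end CyclicQuotient

end

noncomputable section

namespace CyclicQuotient

open MvPolynomial

/-! ### Invariants and their monomials -/

variable {d n : ℕ}

/-! Let `α` be an automorphism of the invariant ring and `yᵢ = α(xᵢ ^ d)`. Applying `α` to `(xⱼ ^ d)
^ (d - 1) * xᵢ ^ d = (xⱼ ^ (d - 1) * xᵢ) ^ d` shows that a prime `p` not dividing `yⱼ` has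
multiplicity divisible by `d` in `yᵢ`. Such a `j` exists for every `p` (`exists_not_dvd_powVar`), so
unique factorization makes each `yᵢ` a `d`-th power `gᵢ ^ d`. Suitable multiples `fᵢ` of `gᵢ` by
roots of unity make `xᵢ ↦ fᵢ` extend `α`. Extensions of `α` and `α⁻¹` compose to maps fixing the
invariants; these only rescale the variables, so both extensions are bijective. -/

theorem scale_monomial (ζ : ℂ) (m : Fin n →₀ ℕ) (c : ℂ) :
    scale n ζ (monomial m c) = monomial m (ζ ^ m.degree * c) := by
  rw [scale, aeval_monomial, monomial_eq, Finsupp.prod_fintype _ _ (by simp),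
    Finsupp.prod_fintype _ _ (by simp), Finsupp.degree_eq_sum]
  simp only [mul_pow, Finset.prod_mul_distrib, Finset.prod_pow_eq_pow_sum, algebraMap_eq, C_mul,
    C_pow]
  ring

theorem coeff_scale (ζ : ℂ) (m : Fin n →₀ ℕ) (f : MvPolynomial (Fin n) ℂ) :
    coeff m (scale n ζ f) = ζ ^ m.degree * coeff m f := by
  induction f using MvPolynomial.induction_on' with
  | monomial u a =>
    rw [scale_monomial, coeff_monomial, coeff_monomial]
    split_ifs with h
    · rw [h]
    · simp
  | add p q hp hq => rw [map_add, coeff_add, coeff_add, hp, hq, mul_add]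

theorem monomial_mem_invariants {m : Fin n →₀ ℕ} (hm : d ∣ m.degree) (c : ℂ) :
    monomial m c ∈ invariants d n := by
  rw [mem_invariants]
  intro ζ
  obtain ⟨k, hk⟩ := hm
  have h : ((ζ : ℂˣ) : ℂ) ^ d = 1 := by
    have := ζ.2
    rw [mem_rootsOfUnity'] at this
    exact this
  rw [scale_monomial, hk, pow_mul, h, one_pow, one_mul]

theorem dvd_degree_of_mem_invariants (hd : d ≠ 0) {f : MvPolynomial (Fin n) ℂ}
    (hf : f ∈ invariants d n) {m : Fin n →₀ ℕ} (hm : m ∈ f.support) : d ∣ m.degree := by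
  have hζ := Complex.isPrimitiveRoot_exp d hd
  have : NeZero d := ⟨hd⟩
  have h := congrArg (coeff m) (mem_invariants.1 hf hζ.toRootsOfUnity)
  rw [coeff_scale] at h
  exact hζ.dvd_of_pow_eq_one _ (mul_right_cancel₀ (mem_support_iff.1 hm) (h.trans (one_mul _).symm))

/-- The monomial `x ^ m`, as an invariant. -/
def invMonomial (m : Fin n →₀ ℕ) (hm : d ∣ m.degree) : invariants d n :=
  ⟨monomial m 1, monomial_mem_invariants hm 1⟩

theorem mem_span_invMonomial (hd : d ≠ 0) (a : invariants d n) :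
    a ∈ Submodule.span ℂ (Set.range fun m : {m : Fin n →₀ ℕ // d ∣ m.degree} =>
      invMonomial m.1 m.2) := by
  have h : a = ∑ m ∈ a.1.support.attach, coeff m.1 a.1 •
      invMonomial m.1 (dvd_degree_of_mem_invariants hd a.2 m.2) := by
    apply Subtype.ext
    rw [AddSubmonoidClass.coe_finsetSum]
    conv_lhs => rw [a.1.as_sum, ← Finset.sum_attach]
    refine Finset.sum_congr rfl fun m _ => ?_
    simp [invMonomial, smul_monomial]
  rw [h]
  exact Submodule.sum_mem _ fun m _ => Submodule.smul_mem _ _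
    (Submodule.subset_span ⟨⟨m.1, dvd_degree_of_mem_invariants hd a.2 m.2⟩, rfl⟩)

/-- The invariant `xᵢ ^ d`. -/
def powVar (d : ℕ) (i : Fin n) : invariants d n :=
  ⟨X i ^ d, by
    rw [X_pow_eq_monomial]
    exact monomial_mem_invariants (by simp) 1⟩

/-- The invariant `xⱼ ^ (d - 1) * xᵢ`. -/
def mixedVar (hd : d ≠ 0) (j i : Fin n) : invariants d n :=
  ⟨X j ^ (d - 1) * X i, by
    rw [X_pow_eq_monomial, X, monomial_mul]
    refine monomial_mem_invariants ?_ _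
    rw [map_add, Finsupp.degree_single, Finsupp.degree_single,
      Nat.sub_add_cancel (Nat.one_le_iff_ne_zero.2 hd)]⟩

theorem monomial_one_eq_prod (m : Fin n →₀ ℕ) :
    (monomial m 1 : MvPolynomial (Fin n) ℂ) = ∏ i, X i ^ m i := by
  rw [monomial_eq, Finsupp.prod_fintype _ _ (by simp), C_1, one_mul]

theorem invMonomial_pow (m : Fin n →₀ ℕ) (hm : d ∣ m.degree) :
    invMonomial m hm ^ d = ∏ i, powVar d i ^ m i := by
  apply Subtype.ext
  simp only [invMonomial, powVar, SubmonoidClass.coe_pow, monomial_one_eq_prod,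
    SubmonoidClass.coe_finsetProd]
  rw [← Finset.prod_pow]
  exact Finset.prod_congr rfl fun i _ => pow_right_comm _ _ _

theorem powVar_pow_mul_powVar (hd : d ≠ 0) (j i : Fin n) :
    powVar d j ^ (d - 1) * powVar d i = mixedVar hd j i ^ d := by
  apply Subtype.ext
  simp only [powVar, mixedVar, SubmonoidClass.coe_pow, MulMemClass.coe_mul]
  rw [mul_pow, pow_right_comm]

/-- Up to a power of `xⱼ ^ d`, which can be cancelled, every invariant monomial is a product of the
`xⱼ ^ (d - 1) * xᵢ`. Hence `α` is determined by its values on these. -/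
theorem prod_mixedVar_pow (hd : d ≠ 0) (j : Fin n) (m : Fin n →₀ ℕ) {k : ℕ}
    (hm : m.degree = d * k) :
    ∏ i, mixedVar hd j i ^ m i =
      powVar d j ^ ((d - 1) * k) * invMonomial m (Dvd.intro _ hm.symm) := by
  apply Subtype.ext
  simp only [powVar, mixedVar, SubmonoidClass.coe_pow, MulMemClass.coe_mul, invMonomial,
    SubmonoidClass.coe_finsetProd, monomial_one_eq_prod]
  simp only [mul_pow, Finset.prod_mul_distrib, Finset.prod_pow_eq_pow_sum]
  rw [← Finsupp.degree_eq_sum, hm]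
  ring

/-! ### Images of the `xᵢ ^ d` are `d`-th powers -/

/-- A nonconstant polynomial in at least two variables cannot divide a polynomial `xᵢ ^ d - cᵢ`
for every `i`. -/
theorem isUnit_of_dvd_X_pow_sub_C (hd : d ≠ 0) (hn : 2 ≤ n) {p : MvPolynomial (Fin n) ℂ}
    (h : ∀ i, ∃ c : ℂ, p ∣ X i ^ d - C c) : IsUnit p := by
  have : Nontrivial (Fin n) := Fin.nontrivial_iff_two_le.2 hn
  have hne : ∀ (i : Fin n) (c : ℂ), (X i ^ d - C c : MvPolynomial (Fin n) ℂ) ≠ 0 := by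
    intro i c h0
    have h1 := congrArg (coeff (Finsupp.single i d)) h0
    rw [coeff_sub, coeff_X_pow, if_pos rfl, coeff_C, if_neg] at h1
    · simp at h1
    · simpa [eq_comm] using hd
  have hp0 : p ≠ 0 := by
    rintro rfl
    obtain ⟨c, hc⟩ := h ⟨0, by omega⟩
    exact hne _ _ (zero_dvd_iff.1 hc)
  have hdeg : ∀ j, degreeOf j p = 0 := by
    intro j
    -- A second variable is needed here: `xᵢ ^ d - c` does not involve `xⱼ`, so neither does its
    -- factor `p`.
    obtain ⟨i, hij⟩ := exists_ne j
    obtain ⟨c, q, hq⟩ := h i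
    have hq0 : q ≠ 0 := by
      rintro rfl
      exact hne i c (by simpa using hq)
    have h1 : degreeOf j (X i ^ d - C c : MvPolynomial (Fin n) ℂ) = 0 := by
      refine Nat.le_zero.1 ((degreeOf_sub_le j _ _).trans ?_)
      rw [degreeOf_C, max_eq_left (Nat.zero_le _)]
      refine (degreeOf_pow_le j _ _).trans ?_
      rw [degreeOf_X_of_ne hij.symm, mul_zero]
    rw [hq, degreeOf_mul_eq hp0 hq0] at h1
    omega
  have hC : p = C (coeff 0 p) := by
    rw [← totalDegree_eq_zero_iff_eq_C, totalDegree_eq_zero_iff]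
    intro m hm i
    exact Nat.le_zero.1 ((monomial_le_degreeOf i hm).trans (hdeg i).le)
  rw [hC]
  refine IsUnit.map C (isUnit_iff_ne_zero.2 fun h0 => hp0 ?_)
  rw [hC, h0, C_0]

/-- No prime divisor is common to the images of all the `xᵢ ^ d` under an automorphism of the
algebra of invariants. -/
theorem exists_not_dvd_powVar (hd : d ≠ 0) (hn : 2 ≤ n) (α : invariants d n ≃ₐ[ℂ] invariants d n)
    {p : MvPolynomial (Fin n) ℂ} (hp : Prime p) :
    ∃ i, ¬ p ∣ (α (powVar d i) : MvPolynomial (Fin n) ℂ) := by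
  by_contra! hall
  have hmon : ∀ (m : Fin n →₀ ℕ) (hm : d ∣ m.degree), m ≠ 0 →
      p ∣ (α (invMonomial m hm) : MvPolynomial (Fin n) ℂ) := by
    intro m hm hm0
    obtain ⟨i, hi⟩ := Finsupp.ne_iff.1 hm0
    refine hp.dvd_of_dvd_pow (n := d) ?_
    rw [← SubmonoidClass.coe_pow, ← map_pow, invMonomial_pow, map_prod,
      SubmonoidClass.coe_finsetProd]
    refine dvd_trans ?_ (Finset.dvd_prod_of_mem _ (Finset.mem_univ i))
    rw [map_pow, SubmonoidClass.coe_pow]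
    exact dvd_pow (hall i) hi
  -- Since `p` divides the image of every nonconstant invariant monomial, each image is constant
  -- modulo `p`. By surjectivity of `α` this includes each `xᵢ ^ d`.
  have hconst : ∀ a : invariants d n, ∃ c : ℂ,
      p ∣ (α a : MvPolynomial (Fin n) ℂ) - C c := by
    intro a
    induction mem_span_invMonomial hd a using Submodule.span_induction with
    | mem x hx =>
      obtain ⟨⟨m, hm⟩, rfl⟩ := hx
      by_cases hm0 : m = 0
      · subst hm0
        refine ⟨1, ?_⟩
        have : invMonomial (0 : Fin n →₀ ℕ) hm = 1 := Subtype.ext (by simp [invMonomial])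
        simp [this]
      · exact ⟨0, by simpa using hmon m hm hm0⟩
    | zero => exact ⟨0, by simp⟩
    | add x y _ _ hx hy =>
      obtain ⟨c, hc⟩ := hx
      obtain ⟨e, he⟩ := hy
      refine ⟨c + e, ?_⟩
      convert dvd_add hc he using 1
      rw [map_add, AddMemClass.coe_add, C_add]
      ring
    | smul r x _ hx =>
      obtain ⟨c, hc⟩ := hx
      refine ⟨r * c, ?_⟩
      convert dvd_mul_of_dvd_right hc (C r) using 1
      rw [map_smul, SetLike.val_smul, smul_eq_C_mul, C_mul]
      ring
  refine hp.not_isUnit (isUnit_of_dvd_X_pow_sub_C hd hn fun i => ?_)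
  obtain ⟨c, hc⟩ := hconst (α.symm (powVar d i))
  exact ⟨c, by simpa [powVar] using hc⟩

theorem coe_map_powVar_ne_zero (α : invariants d n ≃ₐ[ℂ] invariants d n) (i : Fin n) :
    (α (powVar d i) : MvPolynomial (Fin n) ℂ) ≠ 0 := by
  rw [Ne, ZeroMemClass.coe_eq_zero, EmbeddingLike.map_eq_zero_iff]
  exact fun h => pow_ne_zero d (X_ne_zero i) (congrArg Subtype.val h)

/-- An automorphism of the algebra of invariants maps `xᵢ ^ d` to a `d`-th power. -/
theorem exists_pow_eq_map_powVar (hd : d ≠ 0) (hn : 2 ≤ n)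
    (α : invariants d n ≃ₐ[ℂ] invariants d n) (i : Fin n) :
    ∃ f : MvPolynomial (Fin n) ℂ, f ^ d = α (powVar d i) := by
  classical
  have hmk : ∀ i, Associates.mk (α (powVar d i) : MvPolynomial (Fin n) ℂ) ≠ 0 := fun i =>
    Associates.mk_ne_zero.2 (coe_map_powVar_ne_zero α i)
  obtain ⟨b, hb⟩ := Associates.is_pow_of_dvd_count (k := d) (hmk i) (by
    intro q hq
    obtain ⟨p, rfl⟩ := Associates.mk_surjective q
    have hp : Irreducible p := Associates.irreducible_mk.1 hq
    obtain ⟨j, hj⟩ := exists_not_dvd_powVar hd hn α hp.prime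
    have hcount := not_ne_iff.1
      (mt (Associates.count_ne_zero_iff_dvd (coe_map_powVar_ne_zero α j) hp).1 hj)
    have hrel := congrArg (fun a => Associates.mk (α a : MvPolynomial (Fin n) ℂ))
      (powVar_pow_mul_powVar hd j i)
    simp only [map_mul, map_pow, MulMemClass.coe_mul, SubmonoidClass.coe_pow,
      ← Associates.mk_mul_mk, Associates.mk_pow] at hrel
    have hw : Associates.mk (α (mixedVar hd j i) : MvPolynomial (Fin n) ℂ) ≠ 0 := by
      intro h0
      rw [h0, zero_pow hd] at hrel
      exact mul_ne_zero (pow_ne_zero _ (hmk j)) (hmk i) hrel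
    have h2 := congrArg (fun a => (Associates.mk p).count a.factors) hrel
    simp only [Associates.count_mul (pow_ne_zero _ (hmk j)) (hmk i) hq,
      Associates.count_pow (hmk j) hq, Associates.count_pow hw hq, hcount, mul_zero, zero_add] at h2
    exact ⟨_, h2⟩)
  obtain ⟨g, rfl⟩ := Associates.mk_surjective b
  rw [← Associates.mk_pow, Associates.mk_eq_mk_iff_associated] at hb
  obtain ⟨u, hu⟩ := hb.symm
  obtain ⟨c, -, hc⟩ := isUnit_iff_eq_C_of_isReduced.1 u.isUnit
  -- The factorization gives a `d`-th power up to a constant, whose `d`-th root is absorbed into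
  -- `g`.
  obtain ⟨e, he⟩ := IsAlgClosed.exists_pow_nat_eq c (Nat.pos_of_ne_zero hd)
  exact ⟨g * C e, by rw [mul_pow, ← C_pow, he, ← hc, hu]⟩

/-- In `ℂ[x₁, …, xₙ]`, polynomials with the same `d`-th power differ by a root of unity. -/
theorem exists_C_mul_of_pow_eq (hd : d ≠ 0) {f g : MvPolynomial (Fin n) ℂ} (h : f ^ d = g ^ d) :
    ∃ ζ : ℂ, ζ ^ d = 1 ∧ f = C ζ * g := by
  by_cases hg : g = 0
  · subst hg
    rw [zero_pow hd] at h
    exact ⟨1, one_pow _, by simpa using eq_zero_of_pow_eq_zero h⟩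
  have hζ := Complex.isPrimitiveRoot_exp d hd
  have hζC : IsPrimitiveRoot (C (Complex.exp (2 * Real.pi * Complex.I / d)) :
      MvPolynomial (Fin n) ℂ) d := hζ.map_of_injective (C_injective _ _)
  have hprod := hζC.pow_sub_pow_eq_prod_sub_mul f g (Nat.pos_of_ne_zero hd)
  rw [h, sub_self] at hprod
  obtain ⟨ξ, hξ, h0⟩ := Finset.prod_eq_zero_iff.1 hprod.symm
  have hξd := (Polynomial.mem_nthRootsFinset (Nat.pos_of_ne_zero hd) _).1 hξ
  obtain ⟨c, -, hc⟩ := isUnit_iff_eq_C_of_isReduced.1 (IsUnit.of_pow_eq_one hξd hd)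
  subst hc
  exact ⟨c, C_injective (Fin n) ℂ (by simpa using hξd), sub_eq_zero.1 h0⟩

/-! ### Extension to the polynomial ring -/

/-- An automorphism of the algebra of invariants extends to an endomorphism of the polynomial
algebra. -/
theorem exists_algHom_extends (hd : d ≠ 0) (hn : 2 ≤ n)
    (α : invariants d n ≃ₐ[ℂ] invariants d n) :
    ∃ Ψ : MvPolynomial (Fin n) ℂ →ₐ[ℂ] MvPolynomial (Fin n) ℂ,
      ∀ a : invariants d n, Ψ a = α a := by
  let j : Fin n := ⟨0, by omega⟩
  choose g hg using exists_pow_eq_map_powVar hd hn α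
  have hgj : g j ≠ 0 := fun h0 =>
    coe_map_powVar_ne_zero α j (by rw [← hg j, h0, zero_pow hd])
  have hw : ∀ i, ∃ f, (α (mixedVar hd j i) : MvPolynomial (Fin n) ℂ) = g j ^ (d - 1) * f := by
    intro i
    obtain ⟨ζ, -, h⟩ := exists_C_mul_of_pow_eq hd
      (f := (α (mixedVar hd j i) : MvPolynomial (Fin n) ℂ)) (g := g j ^ (d - 1) * g i) (by
        rw [← SubmonoidClass.coe_pow, ← map_pow, ← powVar_pow_mul_powVar, map_mul, map_pow,
          MulMemClass.coe_mul, SubmonoidClass.coe_pow, ← hg, ← hg]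
        ring)
    exact ⟨C ζ * g i, by rw [h]; ring⟩
  choose f hf using hw
  refine ⟨aeval f, fun a => ?_⟩
  induction mem_span_invMonomial hd a using Submodule.span_induction with
  | mem x hx =>
    obtain ⟨⟨m, k, hm⟩, rfl⟩ := hx
    have h := congrArg (fun a => (α a : MvPolynomial (Fin n) ℂ)) (prod_mixedVar_pow hd j m hm)
    simp only [map_prod, map_mul, map_pow, SubmonoidClass.coe_finsetProd, MulMemClass.coe_mul,
      SubmonoidClass.coe_pow, hf, ← hg, mul_pow, Finset.prod_mul_distrib,
      Finset.prod_pow_eq_pow_sum] at h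
    rw [← Finsupp.degree_eq_sum, ← pow_mul, ← pow_mul,
      show (d - 1) * m.degree = d * ((d - 1) * k) by rw [hm]; ring] at h
    have h' := mul_left_cancel₀ (pow_ne_zero _ hgj) h
    rw [← h']
    simp [invMonomial, monomial_one_eq_prod]
  | zero => simp
  | add x y _ _ hx hy => rw [map_add, AddMemClass.coe_add, AddMemClass.coe_add, map_add, hx, hy]
  | smul r x _ hx => rw [map_smul, SetLike.val_smul, SetLike.val_smul, map_smul, hx]

/-- An endomorphism of the polynomial algebra that fixes the invariants is bijective. -/
theorem bijective_of_forall_invariants (hd : d ≠ 0)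
    {Ψ : MvPolynomial (Fin n) ℂ →ₐ[ℂ] MvPolynomial (Fin n) ℂ}
    (h : ∀ a : invariants d n, Ψ a = a) : Function.Bijective Ψ := by
  -- The roots of unity may depend on `i`; bijectivity does not need them to agree.
  have hX : ∀ i, ∃ ζ : ℂ, ζ ^ d = 1 ∧ Ψ (X i) = C ζ * X i := fun i =>
    exists_C_mul_of_pow_eq hd (by simpa [powVar] using h (powVar d i))
  choose ζ hζ hΨ using hX
  have hζ0 : ∀ i, ζ i ≠ 0 := fun i h0 => by simpa [h0, zero_pow hd] using hζ i
  let Φ : MvPolynomial (Fin n) ℂ →ₐ[ℂ] MvPolynomial (Fin n) ℂ :=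
    aeval fun i => C (ζ i)⁻¹ * X i
  have h1 : Φ.comp Ψ = AlgHom.id ℂ _ := by
    ext1 i
    simp only [Φ, AlgHom.comp_apply, hΨ, map_mul, aeval_X, AlgHom.id_apply, algHom_C, algebraMap_eq]
    rw [← mul_assoc, ← C_mul, mul_inv_cancel₀ (hζ0 i), C_1, one_mul]
  have h2 : Ψ.comp Φ = AlgHom.id ℂ _ := by
    ext1 i
    simp only [Φ, AlgHom.comp_apply, hΨ, map_mul, aeval_X, AlgHom.id_apply, algHom_C, algebraMap_eq]
    rw [← mul_assoc, ← C_mul, inv_mul_cancel₀ (hζ0 i), C_1, one_mul]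
  exact Function.bijective_iff_has_inverse.2
    ⟨Φ, DFunLike.congr_fun h1, DFunLike.congr_fun h2⟩

/-- Every automorphism of the algebra of invariants extends to an automorphism of the polynomial
algebra. -/
theorem exists_algEquiv_extends (hd : d ≠ 0) (hn : 2 ≤ n)
    (α : invariants d n ≃ₐ[ℂ] invariants d n) :
    ∃ Ψ : MvPolynomial (Fin n) ℂ ≃ₐ[ℂ] MvPolynomial (Fin n) ℂ,
      ∀ a : invariants d n, Ψ a = α a := by
  obtain ⟨Ψ, hΨ⟩ := exists_algHom_extends hd hn α
  obtain ⟨Φ, hΦ⟩ := exists_algHom_extends hd hn α.symm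
  have h1 : Function.Bijective (Φ.comp Ψ) :=
    bijective_of_forall_invariants hd fun a => by simp [hΨ, hΦ]
  have h2 : Function.Bijective (Ψ.comp Φ) :=
    bijective_of_forall_invariants hd fun a => by simp [hΨ, hΦ]
  rw [AlgHom.coe_comp] at h1 h2
  exact ⟨AlgEquiv.ofBijective Ψ ⟨h1.1.of_comp, h2.2.of_comp⟩, hΨ⟩

end CyclicQuotient

end

/-! ### Translation to schemes -/

theorem proposition3p1 (d n : ℕ) (hd : 1 < d) (hn : 2 ≤ n)
    (φ : CyclicQuotient.quotientVariety d n ≅ CyclicQuotient.quotientVariety d n)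
    (hφ : φ.hom.IsOver CyclicQuotient.base) :
    ∃ ψ : CyclicQuotient.affineSpace n ≅ CyclicQuotient.affineSpace n,
      ψ.hom.IsOver CyclicQuotient.base ∧
        ψ.hom ≫ CyclicQuotient.quotientMap d n = CyclicQuotient.quotientMap d n ≫ φ.hom := by
  let A : CommRingCat := .of (CyclicQuotient.invariants d n)
  let R : CommRingCat := .of (MvPolynomial (Fin n) ℂ)
  let e : A ≅ A := (Scheme.Spec.preimageIso (X := .op A) (Y := .op A) φ).symm.unop.symm
  have he : Spec.map e.hom = φ.hom := Scheme.Spec.map_preimage (X := .op A) (Y := .op A) φ.hom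
  have hover : Spec.map e.hom ≫ Spec.map (CommRingCat.ofHom (algebraMap ℂ A)) =
      Spec.map (CommRingCat.ofHom (algebraMap ℂ A)) := by
    rw [he]
    exact hφ.comp_over
  rw [← Spec.map_comp, Spec.map_inj] at hover
  let α : CyclicQuotient.invariants d n ≃ₐ[ℂ] CyclicQuotient.invariants d n :=
    AlgEquiv.ofRingEquiv (f := e.commRingCatIsoToRingEquiv)
      fun r => DFunLike.congr_fun (congrArg CommRingCat.Hom.hom hover) r
  obtain ⟨Ψ, hΨ⟩ := CyclicQuotient.exists_algEquiv_extends (by omega) hn α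
  let E : R ≅ R := Ψ.toRingEquiv.toCommRingCatIso
  let σ := AffineSpace.SpecIso (Fin n) (.of ℂ)
  refine ⟨σ ≪≫ Scheme.Spec.mapIso E.op ≪≫ σ.symm, ⟨?_⟩, ?_⟩
  · have h : σ.hom ≫ Spec.map (CommRingCat.ofHom MvPolynomial.C) =
        CyclicQuotient.affineSpace n ↘ CyclicQuotient.base := by
      rw [← AffineSpace.SpecIso_inv_over, Iso.hom_inv_id_assoc]
    have hE : CommRingCat.ofHom MvPolynomial.C ≫ E.hom = CommRingCat.ofHom MvPolynomial.C := by
      refine CommRingCat.hom_ext (RingHom.ext fun r => ?_)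
      exact Ψ.commutes r
    change (σ.hom ≫ Spec.map E.hom ≫ σ.inv) ≫ _ = _
    rw [Category.assoc, Category.assoc, AffineSpace.SpecIso_inv_over, ← Spec.map_comp, hE, h]
  · have hcomp : CommRingCat.ofHom (CyclicQuotient.invariants d n).val.toRingHom ≫ E.hom =
        e.hom ≫ CommRingCat.ofHom (CyclicQuotient.invariants d n).val.toRingHom := by
      refine CommRingCat.hom_ext (RingHom.ext fun a => ?_)
      exact hΨ a
    have hSpec : (σ.hom ≫ Spec.map E.hom ≫ σ.inv) ≫ σ.hom ≫
        Spec.map (CommRingCat.ofHom (CyclicQuotient.invariants d n).val.toRingHom) =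
        (σ.hom ≫ Spec.map (CommRingCat.ofHom (CyclicQuotient.invariants d n).val.toRingHom)) ≫
          Spec.map e.hom := by
      simp only [Category.assoc, Iso.inv_hom_id_assoc, ← Spec.map_comp, hcomp]
    rw [he] at hSpec
    exact hSpec
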